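/- Let $n$ be a positive integer and let $f\colon\{0,1\}^n\to\{0,1\}$ be a Boolean function. A real polynomial in $X_1,\dots,X_n$ is called multilinear if it has the form $\sum_{S\subseteq[n]}c_S\prod_{i\in S}X_i$; the degree of a polynomial is its total degree, and the zero polynomial is given degree $0$. Write $\neg f$ for the function $x\mapsto 1-f(x)$ and define: - $\deg(f)$, the degree of the unique multilinear $p\in\mathbb{R}[X_1,\dots,X_n]$ with $p(x)=f(x)$ for all $x\in\{0,1\}^n$; - $\mathrm{ndeg}(f)$, the minimum of $\deg(p)$ over all multilinear $p\in\mathbb{R}[X_1,\dots,X_n]$ such that, for all $x\in\{0,1\}^n$, $p(x)\neq 0$ if and only if $f(x)=1$; - $\mathrm{rdeg}(f)$, the minimum of $\max(\deg(p),\deg(q))$ over all pairs of multilinear $p,q\in\mathbb{R}[X_1,\dots,X_n]$ such that, for all $x\in\{0,1\}^n$, $q(x)\neq 0$ and $p(x)/q(x)=f(x)$; - $D(f)$, the minimum depth of a deterministic decision tree that queries bits of the input $x$ and outputs $f(x)$ at the leaf reached, for every $x\in\{0,1\}^n$. Then $$\deg(f)\;\le\; D(f)\;\le\; 2\,\mathrm{ndeg}(f)^2\,\mathrm{ndeg}(\neg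 f)^2\;\le\; 2\,\mathrm{rdeg}(f)^4 .$$ -/

import Mathlib

/-! Complexity measures of Boolean functions `f : {0,1}^n → {0,1}`, with `{0,1}` modelled by `Bool`
(`false` is `0`, `true` is `1`). -/

namespace BoolFun

/-- The real number `0` or `1` that a bit stands for. -/
def bit (b : Bool) : ℝ := if b then 1 else 0

/-- The value `p(x)` of a real polynomial at a point of the Boolean cube. -/
noncomputable def evalCube {n : ℕ} (p : MvPolynomial (Fin n) ℝ) (x : Fin n → Bool) : ℝ :=
  MvPolynomial.eval (fun i => bit (x i)) p

/-- `p` is multilinear: every variable has exponent at most one in every monomial of `p`. -/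
def IsMultilinear {n : ℕ} (p : MvPolynomial (Fin n) ℝ) : Prop :=
  ∀ m ∈ p.support, ∀ i, m i ≤ 1

theorem isMultilinear_iff_degreeOf {n : ℕ} (p : MvPolynomial (Fin n) ℝ) :
    IsMultilinear p ↔ ∀ i, MvPolynomial.degreeOf i p ≤ 1 := by
  simp only [IsMultilinear, MvPolynomial.degreeOf_le_iff]
  exact ⟨fun h i m hm => h m hm i, fun h m hm i => h i m hm⟩

/-- The multilinear polynomial with value `1` at `a` and value `0` at all other points of the
cube. -/
noncomputable def indicatorPoly {n : ℕ} (a : Fin n → Bool) : MvPolynomial (Fin n) ℝ :=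
  ∏ i, (if a i then MvPolynomial.X i else 1 - MvPolynomial.X i)

theorem evalCube_indicatorPoly {n : ℕ} (a x : Fin n → Bool) :
    evalCube (indicatorPoly a) x = if x = a then 1 else 0 := by
  unfold evalCube indicatorPoly
  rw [map_prod]
  split_ifs with h
  · subst h
    refine Finset.prod_eq_one fun i _ => ?_
    cases hx : x i <;> simp [bit, hx]
  · obtain ⟨i, hi⟩ := Function.ne_iff.1 h
    refine Finset.prod_eq_zero (Finset.mem_univ i) ?_
    cases hx : x i <;> cases ha : a i <;> simp_all [bit]

theorem degreeOf_indicatorPoly_le {n : ℕ} (a : Fin n → Bool) (j : Fin n) :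
    MvPolynomial.degreeOf j (indicatorPoly a) ≤ 1 := by
  unfold indicatorPoly
  refine (MvPolynomial.degreeOf_prod_le j Finset.univ _).trans ?_
  have key : ∀ i, MvPolynomial.degreeOf j
      (if a i then MvPolynomial.X i else 1 - MvPolynomial.X i : MvPolynomial (Fin n) ℝ)
        ≤ if j = i then 1 else 0 := by
    intro i
    have hX : MvPolynomial.degreeOf j (MvPolynomial.X i : MvPolynomial (Fin n) ℝ)
        = if j = i then 1 else 0 := MvPolynomial.degreeOf_X j i
    split_ifs at hX ⊢ with h1 h2 h2
    all_goals first
      | exact hX.le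
      | (refine (MvPolynomial.degreeOf_sub_le j _ _).trans ?_
         rw [hX, MvPolynomial.degreeOf_one]
         simp)
  refine (Finset.sum_le_sum fun i _ => key i).trans ?_
  simp

/-- Every real function on the Boolean cube is represented by exactly one multilinear
polynomial. -/
theorem existsUnique_multilinear {n : ℕ} (g : (Fin n → Bool) → ℝ) :
    ∃! p : MvPolynomial (Fin n) ℝ, IsMultilinear p ∧ ∀ x, evalCube p x = g x := by
  refine ⟨∑ a, MvPolynomial.C (g a) * indicatorPoly a, ⟨?_, ?_⟩, ?_⟩
  · rw [isMultilinear_iff_degreeOf]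
    intro i
    refine (MvPolynomial.degreeOf_sum_le i _ _).trans (Finset.sup_le fun a _ => ?_)
    exact (MvPolynomial.degreeOf_C_mul_le _ i _).trans (degreeOf_indicatorPoly_le a i)
  · intro x
    have h : ∀ a, MvPolynomial.eval (fun i => bit (x i)) (indicatorPoly a)
        = if x = a then 1 else 0 := fun a => evalCube_indicatorPoly a x
    simp [evalCube, h]
  · rintro p ⟨hp, hpe⟩
    rw [← sub_eq_zero]
    set r : MvPolynomial (Fin n) ℝ := ∑ a, MvPolynomial.C (g a) * indicatorPoly a with hr
    have hre : ∀ x, evalCube r x = g x := by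
      intro x
      have h : ∀ a, MvPolynomial.eval (fun i => bit (x i)) (indicatorPoly a)
          = if x = a then 1 else 0 := fun a => evalCube_indicatorPoly a x
      simp [hr, evalCube, h]
    refine MvPolynomial.eq_zero_of_eval_zero_at_prod_finset _ (fun _ => ({0, 1} : Finset ℝ))
      (fun i => ?_) (fun v hv => ?_)
    · have h1 := (isMultilinear_iff_degreeOf p).1 hp i
      have h2 : MvPolynomial.degreeOf i r ≤ 1 :=
        (MvPolynomial.degreeOf_sum_le i _ _).trans (Finset.sup_le fun a _ =>
          (MvPolynomial.degreeOf_C_mul_le _ i _).trans (degreeOf_indicatorPoly_le a i))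
      have h3 := MvPolynomial.degreeOf_sub_le i p r
      have h4 : ({0, 1} : Finset ℝ).card = 2 := by simp
      rw [h4]
      omega
    · have hv' : v = fun i => bit (decide (v i = 1)) := by
        funext i
        have := hv i
        simp only [Finset.mem_insert, Finset.mem_singleton] at this
        rcases this with h | h <;> simp [h, bit]
      rw [hv', map_sub]
      exact sub_eq_zero.2 ((hpe _).trans (hre _).symm)

/-- The unique multilinear real polynomial that agrees with `f` on the cube. -/
noncomputable def multilinearRep {n : ℕ} (f : (Fin n → Bool) → Bool) : MvPolynomial (Fin n) ℝ :=
  (existsUnique_multilinear fun x => bit (f x)).choose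

theorem multilinearRep_spec {n : ℕ} (f : (Fin n → Bool) → Bool) :
    IsMultilinear (multilinearRep f) ∧ ∀ x, evalCube (multilinearRep f) x = bit (f x) :=
  (existsUnique_multilinear fun x => bit (f x)).choose_spec.1

/-- The degree `deg(f)`. -/
noncomputable def deg {n : ℕ} (f : (Fin n → Bool) → Bool) : ℕ :=
  (multilinearRep f).totalDegree

/-- `p / q` is a rational representation of `f`. -/
def IsRationalRep {n : ℕ} (f : (Fin n → Bool) → Bool) (p q : MvPolynomial (Fin n) ℝ) : Prop :=
  IsMultilinear p ∧ IsMultilinear q ∧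
    ∀ x, evalCube q x ≠ 0 ∧ evalCube p x / evalCube q x = bit (f x)

theorem isRationalRep_multilinearRep_one {n : ℕ} (f : (Fin n → Bool) → Bool) :
    IsRationalRep f (multilinearRep f) 1 := by
  refine ⟨(multilinearRep_spec f).1, ?_, fun x => ?_⟩
  · rw [isMultilinear_iff_degreeOf]
    intro i
    simp [MvPolynomial.degreeOf_one]
  · simp [evalCube, ← (multilinearRep_spec f).2 x]

/-- The rational degree `rdeg(f)`: the least `max (deg p) (deg q)` over all rational
representations `p / q` of `f`. -/
noncomputable def rdeg {n : ℕ} (f : (Fin n → Bool) → Bool) : ℕ :=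
  sInf {d | ∃ p q, IsRationalRep f p q ∧ max p.totalDegree q.totalDegree = d}

/-- The minimum in the definition of `rdeg` is attained. -/
theorem exists_rdeg {n : ℕ} (f : (Fin n → Bool) → Bool) :
    ∃ p q, IsRationalRep f p q ∧ max p.totalDegree q.totalDegree = rdeg f :=
  Nat.sInf_mem (s := {d | ∃ p q, IsRationalRep f p q ∧ max p.totalDegree q.totalDegree = d})
    ⟨_, _, _, isRationalRep_multilinearRep_one f, rfl⟩

/-- `p` is a nondeterministic representation of `f`. -/
def IsNondetRep {n : ℕ} (f : (Fin n → Bool) → Bool) (p : MvPolynomial (Fin n) ℝ) : Prop :=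
  IsMultilinear p ∧ ∀ x, evalCube p x ≠ 0 ↔ f x = true

theorem isNondetRep_multilinearRep {n : ℕ} (f : (Fin n → Bool) → Bool) :
    IsNondetRep f (multilinearRep f) := by
  refine ⟨(multilinearRep_spec f).1, fun x => ?_⟩
  rw [(multilinearRep_spec f).2 x]
  cases f x <;> simp [bit]

/-- The nondeterministic degree `ndeg(f)`: the least degree of a nondeterministic representation
of `f`. -/
noncomputable def ndeg {n : ℕ} (f : (Fin n → Bool) → Bool) : ℕ :=
  sInf {d | ∃ p, IsNondetRep f p ∧ p.totalDegree = d}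

/-- The minimum in the definition of `ndeg` is attained. -/
theorem exists_ndeg {n : ℕ} (f : (Fin n → Bool) → Bool) :
    ∃ p, IsNondetRep f p ∧ p.totalDegree = ndeg f :=
  Nat.sInf_mem (s := {d | ∃ p, IsNondetRep f p ∧ p.totalDegree = d})
    ⟨_, _, isNondetRep_multilinearRep f, rfl⟩

/-- The negation `¬f`. -/
def neg {n : ℕ} (f : (Fin n → Bool) → Bool) : (Fin n → Bool) → Bool := fun x => !f x

/-- Deterministic decision trees on `n` input bits. A leaf outputs a bit; an inner node
`query i t₀ t₁` reads the `i`-th input bit and continues with `t₀` if it is `0` and with `t₁` if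
it is `1`. -/
inductive DecisionTree (n : ℕ) : Type
  | leaf (b : Bool) : DecisionTree n
  | query (i : Fin n) (t₀ t₁ : DecisionTree n) : DecisionTree n

/-- The output of a decision tree on an input. -/
def DecisionTree.eval {n : ℕ} : DecisionTree n → (Fin n → Bool) → Bool
  | .leaf b, _ => b
  | .query i t₀ t₁, x => if x i then t₁.eval x else t₀.eval x

/-- The depth of a decision tree: the largest number of queries on a path from the root to a
leaf. -/
def DecisionTree.depth {n : ℕ} : DecisionTree n → ℕ
  | .leaf _ => 0
  | .query _ t₀ t₁ => max t₀.depth t₁.depth + 1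

/-- The decision tree complexity `D(f)`: the least depth of a decision tree that computes `f`. -/
noncomputable def D {n : ℕ} (f : (Fin n → Bool) → Bool) : ℕ :=
  sInf {d | ∃ T : DecisionTree n, (∀ x, T.eval x = f x) ∧ T.depth = d}

theorem exists_decisionTree_of_dependsOn {n : ℕ} (s : Finset (Fin n)) :
    ∀ f : (Fin n → Bool) → Bool, (∀ x y, (∀ i ∈ s, x i = y i) → f x = f y) →
      ∃ T : DecisionTree n, ∀ x, T.eval x = f x := by
  induction s using Finset.induction_on with
  | empty =>
    intro f hf
    exact ⟨.leaf (f fun _ => false), fun x => hf _ _ (by simp)⟩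
  | insert i s _ ih =>
    intro f hf
    have h : ∀ b, ∃ T : DecisionTree n, ∀ x, T.eval x = f (Function.update x i b) := by
      intro b
      refine ih (fun x => f (Function.update x i b)) fun x y hxy => hf _ _ fun j hj => ?_
      by_cases hji : j = i
      · subst hji
        simp
      · simpa [hji] using hxy j (Finset.mem_of_mem_insert_of_ne hj hji)
    obtain ⟨T₀, h₀⟩ := h false
    obtain ⟨T₁, h₁⟩ := h true
    refine ⟨.query i T₀ T₁, fun x => ?_⟩
    cases hx : x i
    · have hu : Function.update x i false = x := by rw [← hx, Function.update_eq_self]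
      simp [DecisionTree.eval, hx, h₀, hu]
    · have hu : Function.update x i true = x := by rw [← hx, Function.update_eq_self]
      simp [DecisionTree.eval, hx, h₁, hu]

/-- The minimum in the definition of `D` is attained. -/
theorem exists_D {n : ℕ} (f : (Fin n → Bool) → Bool) :
    ∃ T : DecisionTree n, (∀ x, T.eval x = f x) ∧ T.depth = D f := by
  obtain ⟨T, hT⟩ := exists_decisionTree_of_dependsOn Finset.univ f fun x y h =>
    congrArg f (funext fun i => h i (Finset.mem_univ i))
  exact Nat.sInf_mem
    (s := {d | ∃ T : DecisionTree n, (∀ x, T.eval x = f x) ∧ T.depth = d}) ⟨_, T, hT, rfl⟩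

end BoolFun

/-! The bound `deg f ≤ D f` reads a decision tree as a polynomial. For the bound on `D f`, let `g`
and `h` of degrees `d` and `e` be nonzero exactly where `f` is `1` and `0` respectively. Every
subcube spanned by a monomial of degree `d` of `g` contains a point with `g ≠ 0`, hence `h = 0`. So
at a maximum of `|h|`, disjoint such monomials contain disjoint blocks of bits whose flips make `h`
vanish, and there are at most `2 * e ^ 2` of those: flipping each block independently with
probability `t` turns the mean of `h` into a univariate polynomial of degree at most `e`, to which
Markov's inequality at `t = 0` applies. The variables in a maximal disjoint family of degree `d`
monomials of `g` meet all of them, so querying these at most `2 * d * e ^ 2` variables lowers the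
degree of `g`, and summing over the degrees gives `D f ≤ d * (d + 1) * e ^ 2`. -/

namespace BoolFun

open Finset Polynomial

section LowDegree

variable {ι κ : Type*}

/-- The function on the cube that the monomial `∏ i ∈ S, X i` induces. -/
noncomputable def cubeMonomial (S : Finset ι) (x : ι → Bool) : ℝ := ∏ i ∈ S, bit (x i)

/-- The real functions on the cube that are induced by a polynomial of degree at most `d`. As
`bit b ^ 2 = bit b`, the multilinear monomials suffice to span them. -/
noncomputable def lowDegree (ι : Type*) (d : ℕ) : Submodule ℝ ((ι → Bool) → ℝ) :=
  Submodule.span ℝ (cubeMonomial '' {S : Finset ι | #S ≤ d})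

theorem cubeMonomial_apply (S : Finset ι) (x : ι → Bool) :
    cubeMonomial S x = if ∀ i ∈ S, x i then 1 else 0 := by
  simp only [cubeMonomial, bit, prod_boole]

theorem cubeMonomial_empty : cubeMonomial (∅ : Finset ι) = 1 := rfl

theorem cubeMonomial_mul [DecidableEq ι] (S T : Finset ι) :
    cubeMonomial S * cubeMonomial T = cubeMonomial (S ∪ T) := by
  funext x
  simp only [Pi.mul_apply, cubeMonomial_apply, mem_union, or_imp, forall_and, ite_and, ite_mul,
    one_mul, zero_mul]

theorem cubeMonomial_piecewise [DecidableEq ι] (S A : Finset ι) (a x : ι → Bool) :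
    cubeMonomial S (A.piecewise a x) = cubeMonomial (S ∩ A) a * cubeMonomial (S \ A) x := by
  have happly : ∀ i, bit (A.piecewise a x i) =
      A.piecewise (fun j => bit (a j)) (fun j => bit (x j)) i := fun i =>
    apply_ite bit (i ∈ A) (a i) (x i)
  simp only [cubeMonomial, happly, prod_piecewise]

theorem cubeMonomial_mem_lowDegree {S : Finset ι} {d : ℕ} (hS : #S ≤ d) :
    cubeMonomial S ∈ lowDegree ι d :=
  Submodule.subset_span ⟨S, hS, rfl⟩

theorem lowDegree_mono {d e : ℕ} (hde : d ≤ e) : lowDegree ι d ≤ lowDegree ι e :=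
  Submodule.span_mono (Set.image_mono fun _ hS => le_trans hS hde)

theorem const_mem_lowDegree (r : ℝ) (d : ℕ) : (fun _ => r) ∈ lowDegree ι d := by
  have hr : (fun _ : ι → Bool => r) = r • cubeMonomial ∅ := by
    funext x
    simp [cubeMonomial_empty]
  exact hr ▸ Submodule.smul_mem _ r (cubeMonomial_mem_lowDegree (by simp))

theorem bit_mem_lowDegree (i : ι) : (fun x : ι → Bool => bit (x i)) ∈ lowDegree ι 1 := by
  have hi : (fun x : ι → Bool => bit (x i)) = cubeMonomial {i} := by
    funext x
    simp [cubeMonomial]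
  exact hi ▸ cubeMonomial_mem_lowDegree (by simp)

theorem mem_lowDegree_zero_iff {g : (ι → Bool) → ℝ} :
    g ∈ lowDegree ι 0 ↔ ∃ r, g = fun _ => r := by
  refine ⟨fun hg => ?_, fun ⟨r, hr⟩ => hr ▸ const_mem_lowDegree r 0⟩
  simp only [lowDegree, Nat.le_zero, card_eq_zero, Set.ofPred_eq_eq_singleton,
    Set.image_singleton, Submodule.mem_span_singleton, cubeMonomial_empty] at hg
  obtain ⟨r, rfl⟩ := hg
  exact ⟨r, by funext x; simp⟩

theorem mul_mem_lowDegree {d e : ℕ} {g h : (ι → Bool) → ℝ} (hg : g ∈ lowDegree ι d)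
    (hh : h ∈ lowDegree ι e) : g * h ∈ lowDegree ι (d + e) := by
  classical
  have hle : lowDegree ι d * lowDegree ι e ≤ lowDegree ι (d + e) := by
    rw [lowDegree, lowDegree, Submodule.span_mul_span, Submodule.span_le]
    rintro _ ⟨_, ⟨S, hS, rfl⟩, _, ⟨T, hT, rfl⟩, rfl⟩
    simp only [cubeMonomial_mul]
    exact cubeMonomial_mem_lowDegree ((card_union_le S T).trans (add_le_add hS hT))
  exact hle (Submodule.mul_mem_mul hg hh)

theorem prod_mem_lowDegree (S : Finset κ) {g : κ → (ι → Bool) → ℝ}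
    (hg : ∀ k ∈ S, g k ∈ lowDegree ι 1) : ∏ k ∈ S, g k ∈ lowDegree ι #S := by
  classical
  induction S using Finset.induction_on with
  | empty => exact const_mem_lowDegree 1 0
  | insert k S hk ih =>
    rw [prod_insert hk, card_insert_of_notMem hk, add_comm]
    exact mul_mem_lowDegree (hg k (mem_insert_self k S))
      (ih fun l hl => hg l (mem_insert_of_mem hl))

theorem comp_mem_lowDegree {d : ℕ} {g : (ι → Bool) → ℝ} (hg : g ∈ lowDegree ι d)
    {φ : (κ → Bool) → ι → Bool} (hφ : ∀ i, (fun y => bit (φ y i)) ∈ lowDegree κ 1) :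
    g ∘ φ ∈ lowDegree κ d := by
  have hle : lowDegree ι d ≤ (lowDegree κ d).comap (LinearMap.funLeft ℝ ℝ φ) := by
    rw [lowDegree, Submodule.span_le]
    rintro _ ⟨S, hS, rfl⟩
    have hprod : cubeMonomial S ∘ φ = ∏ i ∈ S, fun y => bit (φ y i) := by
      funext y
      simp [cubeMonomial]
    exact lowDegree_mono hS (hprod.symm ▸ prod_mem_lowDegree S fun i _ => hφ i :
      cubeMonomial S ∘ φ ∈ lowDegree κ #S)
  exact hle hg

end LowDegree

section Coefficients

variable {ι : Type*} [DecidableEq ι]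

/-- The coefficient of `∏ i ∈ S, X i` in the multilinear polynomial inducing a function on the
cube, by Möbius inversion over the points of the cube with support in `S`. -/
noncomputable def cubeCoeff (S : Finset ι) : ((ι → Bool) → ℝ) →ₗ[ℝ] ℝ :=
  ∑ U ∈ S.powerset, (-1 : ℝ) ^ #(S \ U) • LinearMap.proj fun i => decide (i ∈ U)

theorem cubeCoeff_cubeMonomial (S T : Finset ι) :
    cubeCoeff S (cubeMonomial T) = if S = T then 1 else 0 := by
  by_cases hTS : T ⊆ S
  · -- The alternating sum is the expansion of `∏ i ∈ S, (1 - [i ∉ T])`.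
    have hterm : ∀ U ∈ S.powerset, (-1 : ℝ) ^ #(S \ U) * (if T ⊆ U then 1 else 0) =
        (∏ _i ∈ U, 1) * ∏ i ∈ S \ U, if i ∉ T then -1 else 0 := by
      intro U _
      have hiff : T ⊆ U ↔ ∀ i ∈ S \ U, i ∉ T := by
        grind
      simp only [prod_ite_zero, prod_const, one_pow, one_mul, mul_ite, mul_one, mul_zero, hiff]
    simp only [cubeCoeff, LinearMap.sum_apply, LinearMap.smul_apply, LinearMap.proj_apply,
      smul_eq_mul, cubeMonomial_apply, decide_eq_true_eq, ← subset_iff]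
    rw [sum_congr rfl hterm, ← prod_add]
    have hfactor : ∀ i, (1 + if i ∉ T then -1 else 0 : ℝ) = if i ∈ T then 1 else 0 := by
      intro i
      split_ifs <;> simp
    simp only [hfactor, prod_boole, ← subset_iff, Subset.antisymm_iff, hTS, and_true]
  · have hne : S ≠ T := fun h => hTS h.ge
    rw [if_neg hne, cubeCoeff, LinearMap.sum_apply]
    refine sum_eq_zero fun U hU => ?_
    have hTU : ¬ T ⊆ U := fun h => hTS (h.trans (mem_powerset.1 hU))
    simp [cubeMonomial_apply, ← subset_iff, hTU]

theorem cubeCoeff_singleton (i : ι) (g : (ι → Bool) → ℝ) :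
    cubeCoeff {i} g = g (fun j => decide (j = i)) - g fun _ => false := by
  have hpowerset : ({i} : Finset ι).powerset = {∅, {i}} := rfl
  rw [cubeCoeff, hpowerset, sum_pair (singleton_ne_empty i).symm, add_comm, sub_eq_add_neg]
  simp

theorem cubeCoeff_eq_zero_of_mem_lowDegree {d : ℕ} {g : (ι → Bool) → ℝ}
    (hg : g ∈ lowDegree ι d) {S : Finset ι} (hS : d < #S) : cubeCoeff S g = 0 := by
  have hle : lowDegree ι d ≤ LinearMap.ker (cubeCoeff S) := by
    rw [lowDegree, Submodule.span_le]
    rintro _ ⟨T, hT, rfl⟩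
    have hne : S ≠ T := by
      rintro rfl
      exact hS.not_ge hT
    simp [cubeCoeff_cubeMonomial, hne]
  exact hle hg

theorem exists_piecewise_ne_zero_of_cubeCoeff_ne_zero {M : Finset ι} {g : (ι → Bool) → ℝ}
    (hg : g ∈ lowDegree ι #M) (hM : cubeCoeff M g ≠ 0) (x : ι → Bool) :
    ∃ u, g (M.piecewise u x) ≠ 0 := by
  let restrict : ((ι → Bool) → ℝ) →ₗ[ℝ] ((ι → Bool) → ℝ) :=
    LinearMap.funLeft ℝ ℝ fun u => M.piecewise u x
  -- A monomial of degree at most `#M` other than `M` cannot restrict to a multiple of `M`.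
  have hcoeff : Set.EqOn (cubeCoeff M ∘ₗ restrict) (cubeCoeff M) (lowDegree ι #M) := by
    refine LinearMap.eqOn_span' ?_
    rintro _ ⟨S, hS, rfl⟩
    have hrestrict : restrict (cubeMonomial S) =
        cubeMonomial (S \ M) x • cubeMonomial (S ∩ M) := by
      funext u
      exact (cubeMonomial_piecewise S M u x).trans (mul_comm _ _)
    have hiff : M = S ∩ M ↔ M = S := by
      rw [eq_comm, inter_eq_right]
      exact ⟨fun h => eq_of_subset_of_card_le h hS, fun h => h.le⟩
    rw [LinearMap.comp_apply, hrestrict, map_smul, cubeCoeff_cubeMonomial, cubeCoeff_cubeMonomial]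
    by_cases h : M = S
    · simp [← h, cubeMonomial_empty]
    · simp [hiff, h]
  by_contra! hzero
  have : restrict g = 0 := funext hzero
  exact hM (by rw [← hcoeff hg, LinearMap.comp_apply, this, map_zero])

theorem span_range_cubeMonomial {ι : Type*} [Finite ι] :
    Submodule.span ℝ (Set.range (cubeMonomial : Finset ι → (ι → Bool) → ℝ)) = ⊤ := by
  classical
  have := Fintype.ofFinite ι
  have hind : LinearIndependent ℝ (cubeMonomial : Finset ι → (ι → Bool) → ℝ) := by
    refine Fintype.linearIndependent_iff.2 fun c hc S => ?_
    simpa [cubeCoeff_cubeMonomial] using congrArg (cubeCoeff S) hc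
  exact hind.span_eq_top_of_card_eq_finrank' (by simp)

theorem sum_cubeCoeff_smul_cubeMonomial [Fintype ι] (g : (ι → Bool) → ℝ) :
    ∑ S, cubeCoeff S g • cubeMonomial S = g := by
  have hid : ∑ S : Finset ι, (cubeCoeff S).smulRight (cubeMonomial S) = LinearMap.id := by
    refine LinearMap.ext_on_range span_range_cubeMonomial fun T => ?_
    simp [LinearMap.sum_apply, cubeCoeff_cubeMonomial]
  simpa [LinearMap.sum_apply] using LinearMap.congr_fun hid g

theorem comp_piecewise_mem_lowDegree [Finite ι] {d : ℕ} {g : (ι → Bool) → ℝ} {A : Finset ι}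
    (hg : ∀ S, cubeCoeff S g ≠ 0 → #(S \ A) ≤ d) (a : ι → Bool) :
    (fun x => g (A.piecewise a x)) ∈ lowDegree ι d := by
  have := Fintype.ofFinite ι
  have hexpand : (fun x => g (A.piecewise a x)) =
      ∑ S, (cubeCoeff S g * cubeMonomial (S ∩ A) a) • cubeMonomial (S \ A) := by
    funext x
    conv_lhs => rw [← sum_cubeCoeff_smul_cubeMonomial g]
    simp [cubeMonomial_piecewise, mul_assoc]
  rw [hexpand]
  refine sum_mem fun S _ => ?_
  by_cases hS : cubeCoeff S g = 0
  · simp [hS]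
  · exact Submodule.smul_mem _ _ (cubeMonomial_mem_lowDegree (hg S hS))

end Coefficients

section BiasedMean

variable {κ : Type*} [Fintype κ] [DecidableEq κ]

/-- The mean of a function on the cube at a point with independent bits, each equal to `1` with
probability `t`, as a polynomial in `t`. -/
noncomputable def biasedMean : ((κ → Bool) → ℝ) →ₗ[ℝ] ℝ[X] :=
  ∑ A : κ → Bool, (LinearMap.proj A).smulRight (∏ k, if A k then X else 1 - X)

theorem biasedMean_apply (g : (κ → Bool) → ℝ) :
    biasedMean g = ∑ A : κ → Bool, g A • ∏ k, if A k then X else 1 - X := by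
  simp [biasedMean, LinearMap.sum_apply]

theorem biasedMean_cubeMonomial (S : Finset κ) :
    biasedMean (cubeMonomial S) = X ^ #S := by
  have hfactor : ∀ A : κ → Bool,
      (cubeMonomial S A • ∏ k, if A k then X else 1 - X : ℝ[X]) =
        ∏ k, (if k ∈ S then C (bit (A k)) else 1) * if A k then X else 1 - X := by
    intro A
    rw [prod_mul_distrib, prod_ite_mem, univ_inter, smul_eq_C_mul, cubeMonomial, map_prod]
  have hbit : ∀ k, ∑ b : Bool,
      ((if k ∈ S then C (bit b) else 1) * if b then X else 1 - X : ℝ[X]) =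
        if k ∈ S then X else 1 := by
    intro k
    split_ifs <;> simp [bit]
  rw [biasedMean_apply, sum_congr rfl fun A _ => hfactor A,
    ← Fintype.prod_sum fun (k : κ) (b : Bool) =>
      ((if k ∈ S then C (bit b) else 1) * if b then X else 1 - X : ℝ[X])]
  simp only [hbit, prod_ite_mem, univ_inter, prod_const]

theorem abs_eval_biasedMean_le {g : (κ → Bool) → ℝ} {r t : ℝ} (hg : ∀ A, |g A| ≤ r)
    (ht : t ∈ Set.Icc 0 1) : |(biasedMean g).eval t| ≤ r := by
  let w : (κ → Bool) → ℝ := fun A => ∏ k, if A k then t else 1 - t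
  have hw : ∀ A, 0 ≤ w A := fun A => prod_nonneg fun k _ => by
    split_ifs <;> linarith [ht.1, ht.2]
  have heval : ∀ g, (biasedMean g).eval t = ∑ A, g A * w A := fun g => by
    simp [biasedMean_apply, eval_finsetSum, eval_prod, w, apply_ite (eval t)]
  have hsum : ∑ A, w A = 1 := by
    simpa [heval, cubeMonomial_empty] using
      congrArg (eval t) (biasedMean_cubeMonomial (∅ : Finset κ))
  calc |(biasedMean g).eval t| ≤ ∑ A, |g A * w A| := heval g ▸ abs_sum_le_sum_abs _ _
    _ ≤ ∑ A, r * w A := sum_le_sum fun A _ => by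
      rw [abs_mul, abs_of_nonneg (hw A)]
      exact mul_le_mul_of_nonneg_right (hg A) (hw A)
    _ = r := by rw [← mul_sum, hsum, mul_one]

theorem coeff_biasedMean (g : (κ → Bool) → ℝ) (m : ℕ) :
    (biasedMean g).coeff m = ∑ S ∈ powersetCard m univ, cubeCoeff S g := by
  have hlin : lcoeff ℝ m ∘ₗ biasedMean = ∑ S ∈ powersetCard m (univ : Finset κ), cubeCoeff S := by
    refine LinearMap.ext_on_range span_range_cubeMonomial fun T => ?_
    simp [LinearMap.sum_apply, cubeCoeff_cubeMonomial, biasedMean_cubeMonomial, coeff_X_pow,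
      mem_powersetCard, eq_comm]
  simpa [LinearMap.sum_apply] using LinearMap.congr_fun hlin g

theorem natDegree_biasedMean_le {e : ℕ} {g : (κ → Bool) → ℝ} (hg : g ∈ lowDegree κ e) :
    (biasedMean g).natDegree ≤ e := by
  refine natDegree_le_iff_coeff_eq_zero.2 fun m hm => ?_
  rw [coeff_biasedMean]
  refine sum_eq_zero fun S hS => cubeCoeff_eq_zero_of_mem_lowDegree hg ?_
  rwa [(mem_powersetCard.1 hS).2]

end BiasedMean

section Blocks

/-- Markov's inequality for the derivative at the left endpoint of `[0, 1]`. -/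
theorem abs_coeff_one_le_two_mul_sq {e : ℕ} {p : ℝ[X]} (hdeg : p.natDegree ≤ e)
    (hp : ∀ t ∈ Set.Icc (0 : ℝ) 1, |p.eval t| ≤ 1) : |p.coeff 1| ≤ 2 * (e : ℝ) ^ 2 := by
  have hneg : ∀ p : ℝ[X], p.natDegree ≤ e → (∀ t ∈ Set.Icc (0 : ℝ) 1, |p.eval t| ≤ 1) →
      -p.coeff 1 ≤ 2 * (e : ℝ) ^ 2 := by
    intro p hdeg hp
    let reflect : ℝ[X] := C (1 / 2) * (1 - X)
    have hreflect : reflect.natDegree ≤ 1 := by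
      simp only [reflect]
      compute_degree
    have hcomp : (p.comp reflect).degree ≤ (e : WithBot ℕ) := by
      refine natDegree_le_iff_degree_le.1 (natDegree_comp_le.trans ?_)
      simpa using Nat.mul_le_mul hdeg hreflect
    have hbound : ∀ x ∈ Set.Icc (-1 : ℝ) 1, |(p.comp reflect).eval x| ≤ 1 := by
      intro x hx
      rw [eval_comp]
      refine hp _ ?_
      simp only [reflect, eval_mul, eval_sub, eval_C, eval_one, eval_X]
      constructor <;> linarith [hx.1, hx.2]
    have hchebyshev : (derivative (p.comp reflect)).eval 1 ≤ (e : ℝ) ^ 2 := by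
      simpa [Chebyshev.T_derivative_eq_U, sq] using
        Chebyshev.eval_iterate_derivative_le_of_forall_abs_le_one (k := 1) le_rfl hcomp hbound
    have hderiv : (derivative (p.comp reflect)).eval 1 = -p.coeff 1 / 2 := by
      have hzero : (derivative p).eval 0 = p.coeff 1 := by
        rw [← coeff_zero_eq_eval_zero, coeff_derivative]
        simp
      simp [derivative_comp, reflect, hzero, eval_comp, div_eq_inv_mul]
    linarith
  have hpos := hneg (-p) (by simpa using hdeg) (by simpa using hp)
  rw [coeff_neg, neg_neg] at hpos
  exact abs_le'.2 ⟨hpos, hneg p hdeg hp⟩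

/-- The point `x` with the bits in the block `B` flipped. -/
def flipBits {ι : Type*} [DecidableEq ι] (x : ι → Bool) (B : Finset ι) : ι → Bool :=
  fun i => x i ^^ decide (i ∈ B)

variable {ι κ : Type*} [DecidableEq ι]

theorem flipBits_filter_ne (M : Finset ι) (u x : ι → Bool) :
    flipBits x {i ∈ M | x i ≠ u i} = M.piecewise u x := by
  funext i
  by_cases hi : i ∈ M <;> cases hx : x i <;> cases hu : u i <;> simp [flipBits, hi, hx, hu]

theorem exists_flipBits_ne_zero_of_cubeCoeff_ne_zero {M : Finset ι} {g : (ι → Bool) → ℝ}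
    (hg : g ∈ lowDegree ι #M) (hM : cubeCoeff M g ≠ 0) (x : ι → Bool) :
    ∃ B ⊆ M, g (flipBits x B) ≠ 0 := by
  obtain ⟨u, hu⟩ := exists_piecewise_ne_zero_of_cubeCoeff_ne_zero hg hM x
  exact ⟨{i ∈ M | x i ≠ u i}, filter_subset _ M, by rwa [flipBits_filter_ne]⟩

variable [Fintype κ] {B : κ → Finset ι}

theorem bit_flipBits_biUnion_mem_lowDegree (hB : Pairwise (Function.onFun Disjoint B))
    (x : ι → Bool) (i : ι) :
    (fun A : κ → Bool => bit (flipBits x (({k | A k} : Finset κ).biUnion B) i)) ∈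
      lowDegree κ 1 := by
  by_cases hi : ∃ k, i ∈ B k
  · obtain ⟨k, hk⟩ := hi
    have hunique : ∀ l, i ∈ B l ↔ l = k := fun l =>
      ⟨fun hl => by_contra fun hlk => disjoint_left.1 (hB hlk) hl hk, fun h => h ▸ hk⟩
    have haffine : (fun A : κ → Bool => bit (flipBits x (({k | A k} : Finset κ).biUnion B) i)) =
        (fun _ => bit (x i)) + (1 - 2 * bit (x i)) • fun A => bit (A k) := by
      funext A
      have htwo : (1 + (1 - 2) : ℝ) = 0 := by norm_num
      cases hx : x i <;> cases hA : A k <;> simp [flipBits, hunique, hx, hA, bit, htwo]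
    exact haffine ▸ add_mem (const_mem_lowDegree _ 1) (Submodule.smul_mem _ _ (bit_mem_lowDegree k))
  · push Not at hi
    simpa [flipBits, hi] using const_mem_lowDegree (bit (x i)) 1

theorem abs_sum_flipBits_sub_le {e : ℕ} {h : (ι → Bool) → ℝ} (hh : h ∈ lowDegree ι e)
    (hbound : ∀ y, |h y| ≤ 1) (hB : Pairwise (Function.onFun Disjoint B)) (x : ι → Bool) :
    |∑ k, (h (flipBits x (B k)) - h x)| ≤ 2 * (e : ℝ) ^ 2 := by
  classical
  let flipBlocks : (κ → Bool) → ι → Bool := fun A => flipBits x (({k | A k} : Finset κ).biUnion B)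
  have hlow : h ∘ flipBlocks ∈ lowDegree κ e :=
    comp_mem_lowDegree hh (bit_flipBits_biUnion_mem_lowDegree hB x)
  have hnone : flipBlocks (fun _ => false) = x := by
    funext i
    simp [flipBlocks, flipBits]
  have hsingle : ∀ k, flipBlocks (fun l => decide (l = k)) = flipBits x (B k) := by
    intro k
    funext i
    simp [flipBlocks, flipBits]
  have hcoeff : (biasedMean (h ∘ flipBlocks)).coeff 1 = ∑ k, (h (flipBits x (B k)) - h x) := by
    simp [coeff_biasedMean, powersetCard_one, cubeCoeff_singleton, hnone, hsingle]
  exact hcoeff ▸ abs_coeff_one_le_two_mul_sq (natDegree_biasedMean_le hlow) fun t ht =>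
    abs_eval_biasedMean_le (fun A => hbound _) ht

theorem card_le_two_mul_sq_of_flipBits_eq_zero {e : ℕ} {h : (ι → Bool) → ℝ}
    (hh : h ∈ lowDegree ι e) {x : ι → Bool} (hx : h x ≠ 0) (hmax : ∀ y, |h y| ≤ |h x|)
    (hB : Pairwise (Function.onFun Disjoint B)) (hzero : ∀ k, h (flipBits x (B k)) = 0) :
    Fintype.card κ ≤ 2 * e ^ 2 := by
  have hbound : ∀ y, |((h x)⁻¹ • h) y| ≤ 1 := by
    intro y
    rw [Pi.smul_apply, smul_eq_mul, abs_mul, abs_inv, inv_mul_le_one₀ (abs_pos.2 hx)]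
    exact hmax y
  have hcard := abs_sum_flipBits_sub_le (Submodule.smul_mem _ _ hh) hbound hB x
  simp only [Pi.smul_apply, hzero, smul_eq_mul, mul_zero, inv_mul_cancel₀ hx, zero_sub, sum_const,
    card_univ, nsmul_eq_mul, mul_neg, mul_one, abs_neg, Nat.abs_cast] at hcard
  exact_mod_cast hcard

end Blocks

section HittingSet

variable {ι : Type*} [DecidableEq ι]

theorem exists_card_le_forall_not_disjoint [Finite ι] {d e : ℕ} {g h : (ι → Bool) → ℝ}
    (hd : 0 < d) (hg : g ∈ lowDegree ι d) (hh : h ∈ lowDegree ι e) (hne : h ≠ 0)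
    (hgh : ∀ x, g x ≠ 0 → h x = 0) :
    ∃ A : Finset ι, #A ≤ 2 * e ^ 2 * d ∧
      ∀ S, #S = d → cubeCoeff S g ≠ 0 → ¬ Disjoint S A := by
  classical
  -- Vitali's selection with all sizes zero yields a maximal disjoint subfamily.
  obtain ⟨𝓕, h𝓕, hdisj, hhit⟩ := Vitali.exists_disjoint_subfamily_covering_enlargement
    (fun S : Finset ι => (S : Set ι)) {S | #S = d ∧ cubeCoeff S g ≠ 0} 0 2 one_lt_two
    (fun _ _ => le_rfl) 0 (fun _ _ => le_rfl)
    fun S hS => coe_nonempty.2 (card_pos.1 (hS.1 ▸ hd))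
  have := Fintype.ofFinite 𝓕
  obtain ⟨x, hmax⟩ := Finite.exists_max fun x => |h x|
  have hx : h x ≠ 0 := by
    obtain ⟨y, hy⟩ := Function.ne_iff.1 hne
    exact abs_pos.1 ((abs_pos.2 hy).trans_le (hmax y))
  have hblock : ∀ S : 𝓕, ∃ B ⊆ S.1, h (flipBits x B) = 0 := by
    intro S
    obtain ⟨hcard, hcoeff⟩ := h𝓕 S.2
    obtain ⟨B, hBS, hB⟩ := exists_flipBits_ne_zero_of_cubeCoeff_ne_zero (hcard.symm ▸ hg) hcoeff x
    exact ⟨B, hBS, hgh _ hB⟩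
  choose B hBS hB using hblock
  have hdisjB : Pairwise (Function.onFun Disjoint B) := fun S T hST =>
    (disjoint_coe.1 (hdisj S.2 T.2 (Subtype.coe_ne_coe.2 hST))).mono (hBS S) (hBS T)
  refine ⟨univ.biUnion fun S : 𝓕 => S.1, ?_, fun S hcard hcoeff => ?_⟩
  · calc #(univ.biUnion fun S : 𝓕 => S.1) ≤ Fintype.card 𝓕 * d :=
          card_biUnion_le_card_mul _ _ _ fun S _ => (h𝓕 S.2).1.le
      _ ≤ 2 * e ^ 2 * d :=
          Nat.mul_le_mul_right d (card_le_two_mul_sq_of_flipBits_eq_zero hh hx hmax hdisjB hB)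
  · obtain ⟨T, hT, ⟨i, hiS, hiT⟩, -⟩ := hhit S ⟨hcard, hcoeff⟩
    exact not_disjoint_iff.2 ⟨i, hiS, mem_biUnion.2 ⟨⟨T, hT⟩, mem_univ _, hiT⟩⟩

theorem comp_piecewise_mem_lowDegree_of_forall_not_disjoint [Finite ι] {d : ℕ}
    {g : (ι → Bool) → ℝ} (hg : g ∈ lowDegree ι (d + 1)) {A : Finset ι}
    (hA : ∀ S, #S = d + 1 → cubeCoeff S g ≠ 0 → ¬ Disjoint S A) (a : ι → Bool) :
    (fun x => g (A.piecewise a x)) ∈ lowDegree ι d := by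
  refine comp_piecewise_mem_lowDegree (fun S hS => ?_) a
  have hle : #S ≤ d + 1 := not_lt.1 fun hlt => hS (cubeCoeff_eq_zero_of_mem_lowDegree hg hlt)
  by_cases hdisj : Disjoint S A
  · have : #S ≠ d + 1 := fun heq => hA S heq hS hdisj
    have := card_le_card (sdiff_subset : S \ A ⊆ S)
    omega
  · obtain ⟨i, hiS, hiA⟩ := not_disjoint_iff.1 hdisj
    have : S \ A ⊂ S :=
      (ssubset_iff_of_subset sdiff_subset).2 ⟨i, hiS, fun hi => (mem_sdiff.1 hi).2 hiA⟩
    have := card_lt_card this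
    omega

end HittingSet

section DecisionTree

variable {n : ℕ}

theorem D_le_depth {f : (Fin n → Bool) → Bool} {T : DecisionTree n} (hT : ∀ x, T.eval x = f x) :
    D f ≤ T.depth :=
  Nat.sInf_le ⟨T, hT, rfl⟩

theorem D_const (b : Bool) : D (fun _ : Fin n → Bool => b) = 0 :=
  Nat.le_zero.1 (D_le_depth (T := .leaf b) fun _ => rfl)

theorem D_le_max_update_add_one (f : (Fin n → Bool) → Bool) (i : Fin n) :
    D f ≤ max (D fun x => f (Function.update x i false))
      (D fun x => f (Function.update x i true)) + 1 := by
  obtain ⟨T₀, hT₀, hd₀⟩ := exists_D fun x => f (Function.update x i false)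
  obtain ⟨T₁, hT₁, hd₁⟩ := exists_D fun x => f (Function.update x i true)
  rw [← hd₀, ← hd₁]
  refine D_le_depth (T := .query i T₀ T₁) fun x => ?_
  have hself := Function.update_eq_self i x
  cases hx : x i <;> rw [hx] at hself <;> simp [DecisionTree.eval, hx, hT₀, hT₁, hself]

theorem D_le_card_add_of_piecewise {k : ℕ} (A : Finset (Fin n)) {f : (Fin n → Bool) → Bool}
    (hf : ∀ a, D (fun x => f (A.piecewise a x)) ≤ k) : D f ≤ #A + k := by
  induction A using Finset.induction_on generalizing f with
  | empty => simpa using hf fun _ => false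
  | insert i A hi ih =>
    have hupdate : ∀ b, D (fun x => f (Function.update x i b)) ≤ #A + k := by
      refine fun b => ih fun a => ?_
      have hfix : ∀ x, Function.update (A.piecewise a x) i b =
          (insert i A).piecewise (Function.update a i b) x := fun x => by
        rw [piecewise_insert, Function.update_self, update_piecewise, update_piecewise,
          Function.update_idem]
      simpa only [hfix] using hf (Function.update a i b)
    rw [card_insert_of_notMem hi, add_right_comm]
    exact (D_le_max_update_add_one f i).trans
      (Nat.succ_le_succ (max_le (hupdate false) (hupdate true)))

theorem DecisionTree.bit_eval_mem_lowDegree (T : DecisionTree n) :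
    (fun x => bit (T.eval x)) ∈ lowDegree (Fin n) T.depth := by
  induction T with
  | leaf b => exact const_mem_lowDegree (bit b) 0
  | query i T₀ T₁ ih₀ ih₁ =>
    have hquery : (fun x => bit ((DecisionTree.query i T₀ T₁).eval x)) =
        (fun x => bit (T₀.eval x)) +
          ((fun x => bit (T₁.eval x)) - fun x => bit (T₀.eval x)) * fun x => bit (x i) := by
      funext x
      cases hx : x i <;> simp [DecisionTree.eval, hx, bit]
    have h₀ := lowDegree_mono (le_max_left T₀.depth T₁.depth) ih₀
    have h₁ := lowDegree_mono (le_max_right T₀.depth T₁.depth) ih₁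
    rw [hquery, DecisionTree.depth]
    exact add_mem (lowDegree_mono (Nat.le_succ _) h₀)
      (mul_mem_lowDegree (sub_mem h₁ h₀) (bit_mem_lowDegree i))

theorem D_le_of_mem_lowDegree {d e : ℕ} {f : (Fin n → Bool) → Bool} {g h : (Fin n → Bool) → ℝ}
    (hg : g ∈ lowDegree (Fin n) d) (hh : h ∈ lowDegree (Fin n) e)
    (hgf : ∀ x, g x ≠ 0 ↔ f x = true) (hhf : ∀ x, h x ≠ 0 ↔ f x = false) :
    D f ≤ d * (d + 1) * e ^ 2 := by
  induction d generalizing f g h with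
  | zero =>
    obtain ⟨r, rfl⟩ := mem_lowDegree_zero_iff.1 hg
    have hconst : f = fun _ => decide (r ≠ 0) := by
      funext x
      rw [Bool.eq_iff_iff, ← hgf, decide_eq_true_eq]
    simp [hconst, D_const]
  | succ d ih =>
    by_cases hne : h = 0
    · have hconst : f = fun _ => true := by
        funext x
        simpa [hne] using hhf x
      simp [hconst, D_const]
    have hgh : ∀ x, g x ≠ 0 → h x = 0 := fun x hx => by
      simpa [(hgf x).1 hx] using hhf x
    obtain ⟨A, hcard, hA⟩ := exists_card_le_forall_not_disjoint d.succ_pos hg hh hne hgh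
    have hrestrict : ∀ a, D (fun x => f (A.piecewise a x)) ≤ d * (d + 1) * e ^ 2 := fun a =>
      ih (comp_piecewise_mem_lowDegree_of_forall_not_disjoint hg hA a)
        (comp_piecewise_mem_lowDegree (fun S hS => (card_le_card sdiff_subset).trans
          (not_lt.1 fun hlt => hS (cubeCoeff_eq_zero_of_mem_lowDegree hh hlt))) a)
        (fun x => hgf _) fun x => hhf _
    calc D f ≤ #A + d * (d + 1) * e ^ 2 := D_le_card_add_of_piecewise A hrestrict
      _ ≤ 2 * e ^ 2 * (d + 1) + d * (d + 1) * e ^ 2 := Nat.add_le_add_right hcard _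
      _ = (d + 1) * (d + 1 + 1) * e ^ 2 := by ring

end DecisionTree

section Polynomials

variable {n : ℕ}

theorem evalCube_eq_sum (p : MvPolynomial (Fin n) ℝ) :
    evalCube p = ∑ m ∈ p.support, p.coeff m • cubeMonomial m.support := by
  funext x
  simp only [evalCube, MvPolynomial.eval_eq, Finset.sum_apply, Pi.smul_apply, smul_eq_mul,
    cubeMonomial]
  refine sum_congr rfl fun m _ => congrArg _ (prod_congr rfl fun i hi => ?_)
  have : m i ≠ 0 := Finsupp.mem_support_iff.1 hi
  cases x i <;> simp [bit, this]

theorem evalCube_mem_lowDegree (p : MvPolynomial (Fin n) ℝ) :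
    evalCube p ∈ lowDegree (Fin n) p.totalDegree := by
  rw [evalCube_eq_sum]
  refine sum_mem fun m hm => Submodule.smul_mem _ _ (cubeMonomial_mem_lowDegree ?_)
  calc #m.support ≤ ∑ i ∈ m.support, m i := by
        rw [card_eq_sum_ones]
        exact sum_le_sum fun i hi => Nat.one_le_iff_ne_zero.2 (Finsupp.mem_support_iff.1 hi)
    _ ≤ p.totalDegree := MvPolynomial.le_totalDegree hm

theorem IsMultilinear.apply_eq {p : MvPolynomial (Fin n) ℝ} (hp : IsMultilinear p)
    {m : Fin n →₀ ℕ} (hm : m ∈ p.support) (i : Fin n) : m i = if i ∈ m.support then 1 else 0 := by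
  have := hp m hm i
  split_ifs with hi <;> rw [Finsupp.mem_support_iff] at hi <;> omega

theorem IsMultilinear.cubeCoeff_evalCube {p : MvPolynomial (Fin n) ℝ} (hp : IsMultilinear p)
    {m : Fin n →₀ ℕ} (hm : m ∈ p.support) : cubeCoeff m.support (evalCube p) = p.coeff m := by
  have hinj : ∀ l ∈ p.support, m.support = l.support → m = l := fun l hl hml => by
    ext i
    rw [hp.apply_eq hm, hp.apply_eq hl, hml]
  rw [evalCube_eq_sum, map_sum, sum_eq_single_of_mem m hm fun l hl hlm => ?_]
  · simp [cubeCoeff_cubeMonomial]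
  · have : m.support ≠ l.support := fun h => hlm (hinj l hl h).symm
    simp [cubeCoeff_cubeMonomial, this]

theorem IsMultilinear.totalDegree_le_of_evalCube_mem_lowDegree {d : ℕ}
    {p : MvPolynomial (Fin n) ℝ} (hp : IsMultilinear p) (hd : evalCube p ∈ lowDegree (Fin n) d) :
    p.totalDegree ≤ d := by
  refine Finset.sup_le fun m hm => ?_
  have hdegree : m.sum (fun _ k => k) = #m.support := by
    rw [Finsupp.sum, card_eq_sum_ones]
    exact sum_congr rfl fun i hi => (hp.apply_eq hm i).trans (if_pos hi)
  rw [hdegree]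
  by_contra! hlt
  exact MvPolynomial.mem_support_iff.1 hm
    ((hp.cubeCoeff_evalCube hm).symm.trans (cubeCoeff_eq_zero_of_mem_lowDegree hd hlt))

end Polynomials

section Measures

variable {n : ℕ} {f : (Fin n → Bool) → Bool} {p q : MvPolynomial (Fin n) ℝ}

theorem IsNondetRep.ndeg_le (hp : IsNondetRep f p) : ndeg f ≤ p.totalDegree :=
  Nat.sInf_le ⟨p, hp, rfl⟩

theorem IsRationalRep.evalCube_eq (h : IsRationalRep f p q) (x : Fin n → Bool) :
    evalCube p x = bit (f x) * evalCube q x :=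
  (div_eq_iff (h.2.2 x).1).1 (h.2.2 x).2

theorem IsRationalRep.isNondetRep (h : IsRationalRep f p q) : IsNondetRep f p := by
  refine ⟨h.1, fun x => ?_⟩
  have hqx := (h.2.2 x).1
  cases hf : f x <;> simp [h.evalCube_eq, hf, bit, hqx]

theorem IsMultilinear.sub (hp : IsMultilinear p) (hq : IsMultilinear q) :
    IsMultilinear (p - q) := by
  rw [isMultilinear_iff_degreeOf] at *
  exact fun i => (MvPolynomial.degreeOf_sub_le i p q).trans (max_le (hp i) (hq i))

theorem IsRationalRep.isNondetRep_neg (h : IsRationalRep f p q) :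
    IsNondetRep (neg f) (q - p) := by
  refine ⟨h.2.1.sub h.1, fun x => ?_⟩
  have hqx := (h.2.2 x).1
  have hsub : evalCube (q - p) x = evalCube q x - evalCube p x := map_sub _ q p
  cases hf : f x <;> simp [hsub, h.evalCube_eq, neg, hf, bit, hqx]

theorem deg_le_D (f : (Fin n → Bool) → Bool) : deg f ≤ D f := by
  obtain ⟨hmultilinear, heval⟩ := multilinearRep_spec f
  obtain ⟨T, hT, hdepth⟩ := exists_D f
  have hrep : evalCube (multilinearRep f) = fun x => bit (T.eval x) := by
    funext x
    rw [heval, hT]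
  rw [deg, ← hdepth]
  exact hmultilinear.totalDegree_le_of_evalCube_mem_lowDegree (hrep ▸ T.bit_eval_mem_lowDegree)

theorem D_le_ndeg_mul_ndeg_neg (f : (Fin n → Bool) → Bool) :
    D f ≤ ndeg f * (ndeg f + 1) * ndeg (neg f) ^ 2 := by
  obtain ⟨p, hp, hpdeg⟩ := exists_ndeg f
  obtain ⟨q, hq, hqdeg⟩ := exists_ndeg (neg f)
  rw [← hpdeg, ← hqdeg]
  exact D_le_of_mem_lowDegree (evalCube_mem_lowDegree p) (evalCube_mem_lowDegree q) hp.2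
    fun x => by simpa [neg] using hq.2 x

theorem ndeg_le_rdeg (f : (Fin n → Bool) → Bool) : ndeg f ≤ rdeg f := by
  obtain ⟨p, q, hrep, hdeg⟩ := exists_rdeg f
  exact hrep.isNondetRep.ndeg_le.trans ((le_max_left _ _).trans hdeg.le)

theorem ndeg_neg_le_rdeg (f : (Fin n → Bool) → Bool) : ndeg (neg f) ≤ rdeg f := by
  obtain ⟨p, q, hrep, hdeg⟩ := exists_rdeg f
  calc ndeg (neg f) ≤ (q - p).totalDegree := hrep.isNondetRep_neg.ndeg_le
    _ ≤ max q.totalDegree p.totalDegree := MvPolynomial.totalDegree_sub q p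
    _ = rdeg f := by rw [max_comm, hdeg]

end Measures

end BoolFun

theorem mainTheorem1 (n : ℕ) (f : (Fin n → Bool) → Bool) :
    BoolFun.deg f ≤ BoolFun.D f ∧
    BoolFun.D f ≤ 2 * BoolFun.ndeg f ^ 2 * BoolFun.ndeg (BoolFun.neg f) ^ 2 ∧
    2 * BoolFun.ndeg f ^ 2 * BoolFun.ndeg (BoolFun.neg f) ^ 2 ≤ 2 * BoolFun.rdeg f ^ 4 := by
  refine ⟨BoolFun.deg_le_D f, (BoolFun.D_le_ndeg_mul_ndeg_neg f).trans ?_, ?_⟩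
  · have : BoolFun.ndeg f * (BoolFun.ndeg f + 1) ≤ 2 * BoolFun.ndeg f ^ 2 := by
      nlinarith [Nat.le_self_pow two_ne_zero (BoolFun.ndeg f)]
    exact Nat.mul_le_mul_right _ this
  · calc 2 * BoolFun.ndeg f ^ 2 * BoolFun.ndeg (BoolFun.neg f) ^ 2
        ≤ 2 * BoolFun.rdeg f ^ 2 * BoolFun.rdeg f ^ 2 := by
          gcongr
          · exact BoolFun.ndeg_le_rdeg f
          · exact BoolFun.ndeg_neg_le_rdeg f
      _ = 2 * BoolFun.rdeg f ^ 4 := by ring
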